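/- Let $P$ be a probability measure on a measurable space $X$, and let $\mathcal A,\mathcal B$ be two families of measurable subsets of $X$ whose VC dimensions are both at most $d_0\in\mathbb N$. Assume the usual measurability condition of VC theory: for every $m\in\mathbb N$ and all $s,t\subseteq\{1,\dots,m\}$, the set of all $(z_1,\dots,z_m)\in X^m$ for which there are $A\in\mathcal A$ and $B\in\mathcal B$ with $\{i: z_i\in A\}=s$ and $\{i: z_i\in B\}=t$ is measurable with respect to the completion of $P^m$ (this is automatic, for example, if $\mathcal A$ and $\mathcal B$ are countable). Let $n\in\mathbb N$, let $x_1,\dots,x_n$ be i.i.d. samples from $P$, let $\delta>0$, and put $$k_o = 1000\left(d_0\log(8n)+\log(4/\delta)\right),\qquad \#_n(S)=|\{i: x_i\in S\}|,\qquad P_n(A\mid B)=\frac{\#_n(A\cap B)}{\#_n(B)},$$ where $\log$ is the natural logarithm, and $P(A\mid B)=P(A\cap B)/P(B)$, read as $0$ if $P(B)=0$. Then there is a measurable event of probability at least $1-\delta$ on which, simultaneously for all $A\in\mathcal A$ and all $B\in\mathcal B$ with $\#_n(B)>0$, $$\left|P(A\mid B)-P_n(A\mid B)\right|\le\sqrt{\frac{k_o}{\#_n(B)}}.$$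 (For $\#_n(B)=0$ the right-hand side is understood as $\infty$, so that nothing is claimed.) -/

import Mathlib

open MeasureTheory ProbabilityTheory

/-- A family `𝒞` of subsets of `X` shatters the finite set `S` if every subset of `S` is the trace
on `S` of a member of `𝒞`. -/
def FamilyShatters {X : Type*} (𝒞 : Set (Set X)) (S : Finset X) : Prop :=
  ∀ T : Set X, T ⊆ (S : Set X) → ∃ C ∈ 𝒞, C ∩ (S : Set X) = T

/-- The Vapnik-Chervonenkis dimension of an arbitrary family of subsets of `X`: the supremum,
possibly infinite, of the cardinalities of the finite sets that it shatters. -/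
noncomputable def familyVCDim {X : Type*} (𝒞 : Set (Set X)) : ℕ∞ :=
  ⨆ (S : Finset X) (_ : FamilyShatters 𝒞 S), (S.card : ℕ∞)

/-- The number `#ₙ(B)` of sample points, counted with multiplicity, that fall in `B`. -/
noncomputable def sampleCount {X : Type*} {n : ℕ} (x : Fin n → X) (B : Set X) : ℕ :=
  Set.ncard {i : Fin n | x i ∈ B}

/-- The empirical conditional measure `Pₙ(A | B) = #ₙ(A ∩ B) / #ₙ(B)`, used only for
`#ₙ(B) > 0`. -/
noncomputable def empiricalCond {X : Type*} {n : ℕ} (x : Fin n → X) (A B : Set X) : ℝ :=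
  (sampleCount x (A ∩ B) : ℝ) / (sampleCount x B : ℝ)

/-- The usual measurability condition of Vapnik-Chervonenkis theory, for a pair of families: for
every `m` and every pair of index patterns `s`, `t`, the set of the `m`-point samples on which some
`A ∈ 𝒜` and `B ∈ ℬ` pick out exactly the indices in `s` and in `t` is measurable for the
completion of the product measure `P^m`. It holds, for instance, whenever `𝒜` and `ℬ` are countable
families of measurable sets. -/
def SampleMeasurable {X : Type*} [MeasurableSpace X] (P : Measure X) (𝒜 ℬ : Set (Set X)) : Prop :=
  ∀ (m : ℕ) (s t : Set (Fin m)),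
    NullMeasurableSet
      {x : Fin m → X | ∃ A ∈ 𝒜, ∃ B ∈ ℬ, {i | x i ∈ A} = s ∧ {i | x i ∈ B} = t}
      (Measure.pi fun _ : Fin m => P)

/-! Symmetrization by a ghost sample. If `A`, `B` are bad for a sample, Chebyshev shows that with
probability at least 1/2 an independent ghost sample makes the two halves disagree on `B` or on `A ∩
B` (`half_le_measure_section_disagreementSet`). It therefore suffices to bound the disagreement
event for the double sample, up to a factor 2. That law is invariant under exchanging the two copies
of any index, so it is enough to count the bad swaps of each fixed double sample
(`measure_le_of_ncard_le`). There Sauer-Shelah leaves at most `((2n+1)^d)^2` pairs of patterns, and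
for each pair the difference of the halves is a Rademacher sum whose squared coefficients add up to
at most the number of points in `B`. Hoeffding's inequality thus acts at the scale of the count of
`B` rather than of `n`, which gives the rate. -/

/-! ### Traces of VC families on finite sequences -/

open Classical in
/-- The finite family of index patterns that the members of `𝒞` pick out from the points `z i`. -/
noncomputable def indexTraces {X κ : Type*} [Fintype κ] (𝒞 : Set (Set X)) (z : κ → X) :
    Finset (Finset κ) :=
  {s | ∃ C ∈ 𝒞, (s : Set κ) = z ⁻¹' C}

theorem mem_indexTraces {X κ : Type*} [Fintype κ] {𝒞 : Set (Set X)} {z : κ → X} {s : Finset κ} :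
    s ∈ indexTraces 𝒞 z ↔ ∃ C ∈ 𝒞, (s : Set κ) = z ⁻¹' C := by
  simp [indexTraces]

theorem FamilyShatters.card_le {X : Type*} {𝒞 : Set (Set X)} {S : Finset X} {d : ℕ}
    (hS : FamilyShatters 𝒞 S) (hd : familyVCDim 𝒞 ≤ d) : S.card ≤ d := by
  have h : (S.card : ℕ∞) ≤ familyVCDim 𝒞 :=
    le_iSup₂ (f := fun (S : Finset X) (_ : FamilyShatters 𝒞 S) => (S.card : ℕ∞)) S hS
  exact_mod_cast h.trans hd

-- Shattering separates indices, so no point repeats along a shattered `S`, and the image of `S` is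
-- a shattered set of the same size.
open Classical in
theorem card_le_of_shatters_indexTraces {X κ : Type*} [Fintype κ] {𝒞 : Set (Set X)} {z : κ → X}
    {d : ℕ} (hd : familyVCDim 𝒞 ≤ d) {S : Finset κ} (hS : (indexTraces 𝒞 z).Shatters S) :
    S.card ≤ d := by
  have hinj : Set.InjOn z S := by
    intro i hi j hj hij
    obtain ⟨u, hu, hu'⟩ := hS (t := {i}) (by simpa using hi)
    obtain ⟨C, -, hC⟩ := mem_indexTraces.1 hu
    have hiu : i ∈ u := (Finset.mem_inter.1 (hu' ▸ Finset.mem_singleton_self i)).2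
    have hju : j ∈ u := by
      rw [← Finset.mem_coe, hC, Set.mem_preimage] at hiu ⊢
      rwa [← hij]
    have : j ∈ S ∩ u := Finset.mem_inter.2 ⟨hj, hju⟩
    rw [hu', Finset.mem_singleton] at this
    exact this.symm
  rw [← Finset.card_image_of_injOn hinj]
  refine FamilyShatters.card_le (𝒞 := 𝒞) (fun T hT => ?_) hd
  obtain ⟨u, hu, hu'⟩ := hS (t := S.filter fun i => z i ∈ T) (Finset.filter_subset _ _)
  obtain ⟨C, hC𝒞, hC⟩ := mem_indexTraces.1 hu
  have key : ∀ i ∈ S, (z i ∈ C ↔ z i ∈ T) := by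
    intro i hi
    have h1 : i ∈ u ↔ z i ∈ C := by rw [← Finset.mem_coe, hC, Set.mem_preimage]
    have h2 := Finset.ext_iff.1 hu' i
    simp only [Finset.mem_inter, hi, true_and, Finset.mem_filter] at h2
    rw [← h1, h2]
  refine ⟨C, hC𝒞, ?_⟩
  ext y
  constructor
  · rintro ⟨hyC, hy⟩
    obtain ⟨i, hi, rfl⟩ := Finset.mem_image.1 (Finset.mem_coe.1 hy)
    exact (key i hi).1 hyC
  · intro hy
    have hy' := hT hy
    obtain ⟨i, hi, rfl⟩ := Finset.mem_image.1 (Finset.mem_coe.1 hy')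
    exact ⟨(key i hi).2 hy, hy'⟩

theorem sum_choose_le_succ_pow (m d : ℕ) : ∑ k ∈ Finset.Iic d, m.choose k ≤ (m + 1) ^ d := by
  have hIic : Finset.Iic d = Finset.range (d + 1) := by ext; simp
  rw [add_pow, hIic]
  refine Finset.sum_le_sum fun k hk => ?_
  have hk' : k ≤ d := Nat.lt_succ_iff.1 (Finset.mem_range.1 hk)
  rw [one_pow, mul_one]
  exact (Nat.choose_le_pow _ _).trans (Nat.le_mul_of_pos_right _ (Nat.choose_pos hk'))

/-- The Sauer-Shelah bound for the patterns picked out from a finite sequence of points. -/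
theorem card_indexTraces_le {X κ : Type*} [Fintype κ] {𝒞 : Set (Set X)} (z : κ → X)
    {d : ℕ} (hd : familyVCDim 𝒞 ≤ d) :
    (indexTraces 𝒞 z).card ≤ (Fintype.card κ + 1) ^ d := by
  classical
  have hvc : (indexTraces 𝒞 z).vcDim ≤ d := Finset.sup_le fun S hS =>
    card_le_of_shatters_indexTraces hd (Finset.mem_shatterer.1 hS)
  calc (indexTraces 𝒞 z).card ≤ _ := Finset.card_le_card_shatterer _
    _ ≤ _ := Finset.card_shatterer_le_sum_vcDim
    _ ≤ ∑ k ∈ Finset.Iic d, (Fintype.card κ).choose k :=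
        Finset.sum_le_sum_of_subset (Finset.Iic_subset_Iic.2 hvc)
    _ ≤ _ := sum_choose_le_succ_pow _ _

/-! ### Rademacher sums -/

/-- The sign attached to a Boolean. -/
def boolSign (b : Bool) : ℝ := if b then -1 else 1

/-- The sum factors over indices into terms `2 cosh (c i)`, and `cosh c ≤ exp (c² / 2)`. -/
theorem sum_exp_boolSign_le {ι : Type*} [Fintype ι] [DecidableEq ι] (c : ι → ℝ) :
    ∑ ε : ι → Bool, Real.exp (∑ i, boolSign (ε i) * c i) ≤
      2 ^ Fintype.card ι * Real.exp ((∑ i, c i ^ 2) / 2) := by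
  have h := Finset.prod_univ_sum (fun _ : ι => (Finset.univ : Finset Bool))
    (fun i b => Real.exp (boolSign b * c i))
  rw [Fintype.piFinset_univ] at h
  simp_rw [Real.exp_sum, ← h, Finset.sum_div, Real.exp_sum]
  rw [← Finset.card_univ, ← Finset.prod_const, ← Finset.prod_mul_distrib]
  refine Finset.prod_le_prod (fun i _ => by positivity) fun i _ => ?_
  have := Real.cosh_le_exp_half_sq (c i)
  rw [Real.cosh_eq] at this
  simp only [Fintype.sum_bool, boolSign]
  norm_num
  linarith

/-- Hoeffding's inequality for Rademacher sums, in counting form. -/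
theorem card_boolSign_sum_sq_gt_le {ι : Type*} [Fintype ι] [DecidableEq ι] (c : ι → ℝ) {v k : ℝ}
    (hv : ∑ i, c i ^ 2 ≤ v) (hk : 0 ≤ k) :
    (Set.ncard {ε : ι → Bool | 4 * k * v < (∑ i, boolSign (ε i) * c i) ^ 2} : ℝ) ≤
      2 * 2 ^ Fintype.card ι * Real.exp (-(2 * k)) := by
  classical
  have hv0 : 0 ≤ v := (Finset.sum_nonneg fun i _ => sq_nonneg _).trans hv
  rcases hv0.eq_or_lt with rfl | hvpos
  · have hc : ∀ i, c i = 0 := by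
      have h0 := le_antisymm hv (Finset.sum_nonneg fun i _ => sq_nonneg _)
      rw [Finset.sum_eq_zero_iff_of_nonneg fun i _ => sq_nonneg _] at h0
      exact fun i => by simpa using h0 i (Finset.mem_univ i)
    simp only [hc, mul_zero, Finset.sum_const_zero]
    norm_num
    positivity
  set S : (ι → Bool) → ℝ := fun ε => ∑ i, boolSign (ε i) * c i with hS
  -- The optimal Chernoff parameter for the threshold `2√(kv)`: the moment costs `exp (2k)` and the
  -- deviation gains `exp (4k)`.
  set l : ℝ := 2 * √(k / v) with hl
  have hl2 : l ^ 2 * v = 4 * k := by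
    rw [hl, mul_pow, Real.sq_sqrt (by positivity)]
    field_simp
    ring
  have hexp : ∀ l : ℝ, l ^ 2 * v = 4 * k →
      ∑ ε, Real.exp (l * S ε) ≤ 2 ^ Fintype.card ι * Real.exp (2 * k) := by
    intro l hl
    have h := sum_exp_boolSign_le fun i => l * c i
    have h1 : ∀ ε : ι → Bool, ∑ i, boolSign (ε i) * (l * c i) = l * S ε := by
      intro ε
      rw [hS, Finset.mul_sum]
      exact Finset.sum_congr rfl fun i _ => by ring
    simp_rw [h1, mul_pow, ← Finset.mul_sum] at h
    refine h.trans ?_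
    gcongr
    nlinarith [mul_le_mul_of_nonneg_left hv (sq_nonneg l)]
  have hpt : ∀ ε, 4 * k * v < S ε ^ 2 →
      Real.exp (4 * k) ≤ Real.exp (l * S ε) + Real.exp (-l * S ε) := by
    intro ε hε
    have h1 : 4 * k ≤ |l * S ε| := by
      refine abs_le_of_sq_le_sq' ?_ (abs_nonneg _) |>.2
      rw [sq_abs, mul_pow l]
      have h2 : l ^ 2 * (4 * k * v) ≤ l ^ 2 * S ε ^ 2 :=
        mul_le_mul_of_nonneg_left hε.le (sq_nonneg _)
      calc (4 * k) ^ 2 = l ^ 2 * v * (4 * k) := by rw [hl2]; ring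
        _ ≤ _ := by linarith
    rcases abs_cases (l * S ε) with ⟨h, -⟩ | ⟨h, -⟩
    · have := Real.exp_le_exp.2 (h1.trans h.le)
      linarith [Real.exp_pos (-l * S ε)]
    · have := Real.exp_le_exp.2 (h1.trans h.le)
      rw [neg_mul]
      linarith [Real.exp_pos (l * S ε)]
  have hcount : (Set.ncard {ε : ι → Bool | 4 * k * v < S ε ^ 2} : ℝ) * Real.exp (4 * k) ≤
      2 * 2 ^ Fintype.card ι * Real.exp (2 * k) := by
    rw [Set.ncard_eq_toFinset_card', ← nsmul_eq_mul, ← Finset.sum_const]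
    calc ∑ _ε ∈ {ε : ι → Bool | 4 * k * v < S ε ^ 2}.toFinset, Real.exp (4 * k)
        ≤ ∑ ε ∈ {ε : ι → Bool | 4 * k * v < S ε ^ 2}.toFinset,
            (Real.exp (l * S ε) + Real.exp (-l * S ε)) :=
          Finset.sum_le_sum fun ε hε => hpt ε (by simpa using hε)
      _ ≤ ∑ ε, (Real.exp (l * S ε) + Real.exp (-l * S ε)) :=
          Finset.sum_le_sum_of_subset_of_nonneg (Finset.subset_univ _)
            fun _ _ _ => by positivity
      _ ≤ _ := by
          rw [Finset.sum_add_distrib]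
          linarith [hexp l hl2, hexp (-l) (by rw [neg_sq, hl2])]
  have h4 : Real.exp (2 * k) = Real.exp (-(2 * k)) * Real.exp (4 * k) := by
    rw [← Real.exp_add]; ring_nf
  rw [h4, ← mul_assoc] at hcount
  exact le_of_mul_le_mul_right hcount (Real.exp_pos _)

/-! ### Random swaps of a double sample -/

/-- The permutation of the indices of a double sample that exchanges the two copies of every index
selected by `ε`. -/
def pairSwap {ι : Type*} (ε : ι → Bool) : Equiv.Perm (ι ⊕ ι) where
  toFun := Sum.elim (fun i => if ε i then .inr i else .inl i)
    (fun i => if ε i then .inl i else .inr i)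
  invFun := Sum.elim (fun i => if ε i then .inr i else .inl i)
    (fun i => if ε i then .inl i else .inr i)
  left_inv := by rintro (i | i) <;> by_cases h : ε i <;> simp [h]
  right_inv := by rintro (i | i) <;> by_cases h : ε i <;> simp [h]

/-- The number of first-half indices in `s` minus the number of second-half ones. -/
noncomputable def halfDiff {ι : Type*} [Fintype ι] (s : Set (ι ⊕ ι)) : ℝ :=
  ∑ i, (s.indicator 1 (.inl i) - s.indicator 1 (.inr i))

/-- The number of indices in `s`. -/
noncomputable def halfSum {ι : Type*} [Fintype ι] (s : Set (ι ⊕ ι)) : ℝ :=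
  ∑ i, (s.indicator 1 (.inl i) + s.indicator 1 (.inr i))

/-- The halves of the double sample disagree on `t`, or on its part in `s`, by more than a multiple
of the standard deviation. -/
def HalvesDisagree {ι : Type*} [Fintype ι] (k : ℝ) (s t : Set (ι ⊕ ι)) : Prop :=
  4 * k * halfSum t < halfDiff (s ∩ t) ^ 2 ∨ 4 * k * halfSum t < halfDiff t ^ 2

theorem halfDiff_preimage_pairSwap {ι : Type*} [Fintype ι] (ε : ι → Bool) (s : Set (ι ⊕ ι)) :
    halfDiff (pairSwap ε ⁻¹' s) =
      ∑ i, boolSign (ε i) * (s.indicator 1 (.inl i) - s.indicator 1 (.inr i)) := by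
  classical
  refine Finset.sum_congr rfl fun i _ => ?_
  by_cases h : ε i <;> simp [pairSwap, h, boolSign, Set.indicator_apply]

theorem halfSum_preimage_pairSwap {ι : Type*} [Fintype ι] (ε : ι → Bool) (s : Set (ι ⊕ ι)) :
    halfSum (pairSwap ε ⁻¹' s) = halfSum s := by
  classical
  refine Finset.sum_congr rfl fun i _ => ?_
  by_cases h : ε i <;> simp [pairSwap, h, Set.indicator_apply, add_comm]

/-- A pair contributes 0 or 1 on the left, and 1 only when one of its copies lies in `s`, hence in
`t`. Since swaps fix `halfSum t`, this serves as a variance bound for all of them. -/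
theorem sum_sq_sub_le_halfSum {ι : Type*} [Fintype ι] {s t : Set (ι ⊕ ι)} (hst : s ⊆ t) :
    ∑ i, (s.indicator (1 : ι ⊕ ι → ℝ) (.inl i) - s.indicator 1 (.inr i)) ^ 2 ≤ halfSum t := by
  classical
  refine Finset.sum_le_sum fun i _ => ?_
  have h1 := @hst (.inl i)
  have h2 := @hst (.inr i)
  simp only [Set.indicator_apply, Pi.one_apply]
  split_ifs <;> first | (exfalso; tauto) | norm_num

theorem ncard_pairSwap_halvesDisagree_le {ι : Type*} [Fintype ι] {k : ℝ} (hk : 0 ≤ k)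
    (s t : Set (ι ⊕ ι)) :
    (Set.ncard {ε : ι → Bool | HalvesDisagree k (pairSwap ε ⁻¹' s) (pairSwap ε ⁻¹' t)} : ℝ) ≤
      4 * 2 ^ Fintype.card ι * Real.exp (-(2 * k)) := by
  classical
  have h1 := card_boolSign_sum_sq_gt_le _
    (sum_sq_sub_le_halfSum (Set.inter_subset_right (s := s) (t := t))) hk
  have h2 := card_boolSign_sum_sq_gt_le _ (sum_sq_sub_le_halfSum (subset_refl t)) hk
  simp only [HalvesDisagree, ← Set.preimage_inter, halfSum_preimage_pairSwap,
    halfDiff_preimage_pairSwap, Set.ofPred_or]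
  refine (Nat.cast_le.2 (Set.ncard_union_le _ _)).trans ?_
  push_cast
  linarith

/-- The double samples on which the two halves disagree for some `A ∈ 𝒜` and `B ∈ ℬ`. -/
def disagreementSet {X ι : Type*} [Fintype ι] (𝒜 ℬ : Set (Set X)) (k : ℝ) : Set (ι ⊕ ι → X) :=
  {z | ∃ A ∈ 𝒜, ∃ B ∈ ℬ, HalvesDisagree k (z ⁻¹' A) (z ⁻¹' B)}

theorem ncard_pairSwap_disagreementSet_le {X ι : Type*} [Fintype ι] {𝒜 ℬ : Set (Set X)} {d : ℕ}
    (h𝒜 : familyVCDim 𝒜 ≤ d) (hℬ : familyVCDim ℬ ≤ d) {k : ℝ} (hk : 0 ≤ k) (z : ι ⊕ ι → X) :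
    (Set.ncard {ε : ι → Bool | z ∘ pairSwap ε ∈ disagreementSet 𝒜 ℬ k} : ℝ) ≤
      (((2 * Fintype.card ι + 1) ^ d) ^ 2 * (4 * Real.exp (-(2 * k)))) * 2 ^ Fintype.card ι := by
  classical
  -- Patterns are taken on the unswapped `z`, so the union bound runs over a family independent of
  -- `ε`.
  have hsub : {ε : ι → Bool | z ∘ pairSwap ε ∈ disagreementSet 𝒜 ℬ k} ⊆
      ⋃ p ∈ indexTraces 𝒜 z ×ˢ indexTraces ℬ z,
        {ε : ι → Bool | HalvesDisagree k (pairSwap ε ⁻¹' p.1) (pairSwap ε ⁻¹' p.2)} := by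
    rintro ε ⟨A, hA, B, hB, h⟩
    refine Set.mem_iUnion₂.2 ⟨((z ⁻¹' A).toFinset, (z ⁻¹' B).toFinset), ?_, ?_⟩
    · exact Finset.mem_product.2 ⟨mem_indexTraces.2 ⟨A, hA, by simp⟩,
        mem_indexTraces.2 ⟨B, hB, by simp⟩⟩
    · simpa [Set.preimage_comp] using h
  have hcard : ((indexTraces 𝒜 z ×ˢ indexTraces ℬ z).card : ℝ) ≤
      ((2 * Fintype.card ι + 1) ^ d) ^ 2 := by
    have h1 := card_indexTraces_le z h𝒜
    have h2 := card_indexTraces_le z hℬ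
    rw [Fintype.card_sum, ← two_mul] at h1 h2
    rw [Finset.card_product, sq]
    exact_mod_cast Nat.mul_le_mul h1 h2
  calc _ ≤ ((∑ p ∈ indexTraces 𝒜 z ×ˢ indexTraces ℬ z, Set.ncard
        {ε : ι → Bool | HalvesDisagree k (pairSwap ε ⁻¹' p.1) (pairSwap ε ⁻¹' p.2)} : ℕ) : ℝ) :=
        Nat.cast_le.2 ((Set.ncard_le_ncard hsub (Set.toFinite _)).trans
          (Finset.set_ncard_biUnion_le _ _))
    _ ≤ ∑ _p ∈ indexTraces 𝒜 z ×ˢ indexTraces ℬ z,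
          4 * 2 ^ Fintype.card ι * Real.exp (-(2 * k)) := by
        push_cast
        exact Finset.sum_le_sum fun p _ => ncard_pairSwap_halvesDisagree_le hk _ _
    _ ≤ _ := by
        rw [Finset.sum_const, nsmul_eq_mul]
        refine (mul_le_mul_of_nonneg_right hcard (by positivity)).trans_eq ?_
        ring

/-! ### Measure of the disagreement event -/

/-- If under every point the proportion of the measure-preserving maps `σ τ` that send it to `G` is
at most `c`, then `G` has measure at most `c`. -/
theorem measure_le_of_ncard_le {Z T : Type*} [MeasurableSpace Z] {ν : Measure Z}
    [IsProbabilityMeasure ν] [Fintype T] [Nonempty T] {σ : T → Z → Z}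
    (hσ : ∀ τ, MeasurePreserving (σ τ) ν ν) {G : Set Z} (hG : NullMeasurableSet G ν) {c : ℝ}
    (h : ∀ z, (Set.ncard {τ | σ τ z ∈ G} : ℝ) ≤ c * Fintype.card T) :
    ν G ≤ ENNReal.ofReal c := by
  classical
  have hpre : ∀ τ, NullMeasurableSet (σ τ ⁻¹' G) ν := fun τ =>
    hG.preimage (hσ τ).quasiMeasurePreserving
  have hsum : (Fintype.card T : ENNReal) * ν G =
      ∫⁻ z, ∑ τ, (σ τ ⁻¹' G).indicator 1 z ∂ν := by
    rw [lintegral_finsetSum' _ fun τ _ => ?_]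
    · simp_rw [lintegral_indicator_one₀ (hpre _), (hσ _).measure_preimage hG]
      simp
    · exact (measurable_one.aemeasurable).indicator₀ (hpre τ)
  have hpt : ∀ z, ∑ τ, (σ τ ⁻¹' G).indicator (1 : Z → ENNReal) z ≤
      ENNReal.ofReal c * Fintype.card T := by
    intro z
    have h1 : ∑ τ, (σ τ ⁻¹' G).indicator (1 : Z → ENNReal) z = (Set.ncard {τ | σ τ z ∈ G} : ℕ) := by
      rw [Set.ncard_eq_toFinset_card']
      simp [Set.indicator_apply]
    rw [h1, ← ENNReal.ofReal_natCast, ← ENNReal.ofReal_natCast,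
      ← ENNReal.ofReal_mul' (by positivity)]
    exact ENNReal.ofReal_le_ofReal (h z)
  have hle : (Fintype.card T : ENNReal) * ν G ≤ Fintype.card T * ENNReal.ofReal c := by
    rw [hsum, mul_comm]
    refine (lintegral_mono hpt).trans_eq ?_
    simp
  exact (ENNReal.mul_le_mul_iff_right (by simp) (by simp)).1 hle

theorem measurePreserving_comp_equiv {X κ κ' : Type*} [Fintype κ] [Fintype κ'] [MeasurableSpace X]
    (P : Measure X) [IsProbabilityMeasure P] (e : κ' ≃ κ) :
    MeasurePreserving (fun z : κ → X => z ∘ e) (Measure.pi fun _ => P) (Measure.pi fun _ => P) := by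
  convert! measurePreserving_piCongrLeft (α := fun _ : κ' => X) (fun _ => P) e.symm using 1
  ext z i
  have h := Equiv.piCongrLeft_apply_apply (fun _ : κ' => X) e.symm z (e i)
  rw [Equiv.symm_apply_apply] at h
  exact h.symm

/-- Disagreement depends only on the two index patterns, so the event is a finite union of the sets
in `SampleMeasurable`, reindexed by `Fin (n + n)`. -/
theorem nullMeasurableSet_disagreementSet {X : Type*} [MeasurableSpace X] {P : Measure X}
    [IsProbabilityMeasure P] {𝒜 ℬ : Set (Set X)} (hmeas : SampleMeasurable P 𝒜 ℬ) (n : ℕ) (k : ℝ) :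
    NullMeasurableSet (disagreementSet (ι := Fin n) 𝒜 ℬ k) (Measure.pi fun _ => P) := by
  have heq : disagreementSet (ι := Fin n) 𝒜 ℬ k =
      ⋃ p ∈ {p : Set (Fin n ⊕ Fin n) × Set (Fin n ⊕ Fin n) | HalvesDisagree k p.1 p.2},
        (fun z : Fin n ⊕ Fin n → X => z ∘ finSumFinEquiv.symm) ⁻¹'
          {x | ∃ A ∈ 𝒜, ∃ B ∈ ℬ, {i | x i ∈ A} = finSumFinEquiv.symm ⁻¹' p.1 ∧
            {i | x i ∈ B} = finSumFinEquiv.symm ⁻¹' p.2} := by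
    ext z
    simp only [Set.mem_iUnion, Set.mem_preimage, Set.mem_ofPred_eq, exists_prop]
    constructor
    · rintro ⟨A, hA, B, hB, h⟩
      exact ⟨(z ⁻¹' A, z ⁻¹' B), h, A, hA, B, hB, rfl, rfl⟩
    · rintro ⟨p, h, A, hA, B, hB, h1, h2⟩
      have h1' : z ⁻¹' A = p.1 := finSumFinEquiv.symm.surjective.preimage_injective h1
      have h2' : z ⁻¹' B = p.2 := finSumFinEquiv.symm.surjective.preimage_injective h2
      exact ⟨A, hA, B, hB, by rwa [h1', h2']⟩
  rw [heq]
  refine NullMeasurableSet.biUnion (Set.to_countable _) fun p _ => ?_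
  exact (hmeas (n + n) _ _).preimage
    (measurePreserving_comp_equiv P finSumFinEquiv.symm).quasiMeasurePreserving

theorem measure_disagreementSet_le {X : Type*} [MeasurableSpace X] {P : Measure X}
    [IsProbabilityMeasure P] {𝒜 ℬ : Set (Set X)} (hmeas : SampleMeasurable P 𝒜 ℬ) {d : ℕ}
    (h𝒜 : familyVCDim 𝒜 ≤ d) (hℬ : familyVCDim ℬ ≤ d) (n : ℕ) {k : ℝ} (hk : 0 ≤ k) :
    (Measure.pi fun _ => P) (disagreementSet (ι := Fin n) 𝒜 ℬ k) ≤
      ENNReal.ofReal (((2 * n + 1) ^ d) ^ 2 * (4 * Real.exp (-(2 * k)))) := by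
  refine measure_le_of_ncard_le (σ := fun (ε : Fin n → Bool) z => z ∘ pairSwap ε)
    (fun ε => measurePreserving_comp_equiv P (pairSwap ε))
    (nullMeasurableSet_disagreementSet hmeas n k) fun z => ?_
  simpa using ncard_pairSwap_disagreementSet_le h𝒜 hℬ hk z

/-! ### The ghost sample -/

theorem sampleCount_eq_sum {X : Type*} {n : ℕ} (x : Fin n → X) (B : Set X) :
    (sampleCount x B : ℝ) = ∑ i, B.indicator 1 (x i) := by
  classical
  rw [sampleCount, Set.ncard_eq_toFinset_card']
  simp [Set.indicator_apply]

theorem halfSum_sumElim {X : Type*} {n : ℕ} (x y : Fin n → X) (B : Set X) :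
    halfSum (Sum.elim x y ⁻¹' B) = sampleCount x B + sampleCount y B := by
  rw [sampleCount_eq_sum, sampleCount_eq_sum, ← Finset.sum_add_distrib]
  rfl

theorem halfDiff_sumElim {X : Type*} {n : ℕ} (x y : Fin n → X) (B : Set X) :
    halfDiff (Sum.elim x y ⁻¹' B) = sampleCount x B - sampleCount y B := by
  rw [sampleCount_eq_sum, sampleCount_eq_sum, ← Finset.sum_sub_distrib]
  rfl

/-- Chebyshev's inequality for an empirical sum of a function dominated by the indicator of `B`. -/
theorem pi_sum_deviation_le {X : Type*} [MeasurableSpace X] {P : Measure X}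
    [IsProbabilityMeasure P] (n : ℕ) {f : X → ℝ} (hf : Measurable f) {B : Set X}
    (hB : MeasurableSet B) (hfB : ∀ y, |f y| ≤ B.indicator 1 y) :
    (Measure.pi fun _ : Fin n => P)
      {x | 4 * (n * P.real B + 1) ≤ (∑ i, f (x i) - n * ∫ y, f y ∂P) ^ 2} ≤ 1 / 4 := by
  classical
  have hf1 : ∀ y, |f y| ≤ 1 := fun y => (hfB y).trans (Set.indicator_le_self' (by simp) y)
  have hfL : MemLp f 2 P := MemLp.of_bound hf.aestronglyMeasurable 1 (.of_forall hf1)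
  have hfi : ∀ i : Fin n, MemLp (fun x : Fin n → X => f (x i)) 2 (Measure.pi fun _ => P) :=
    fun i => hfL.comp_measurePreserving (measurePreserving_eval (fun _ : Fin n => P) i)
  have hvar : Var[f; P] ≤ P.real B := by
    refine (variance_le_expectation_sq hf.aestronglyMeasurable).trans ?_
    rw [← integral_indicator_one hB]
    refine integral_mono hfL.integrable_sq ((integrable_const 1).indicator hB) fun y => ?_
    have h1 := hfB y
    have h2 := sq_abs (f y)
    simp only [Pi.pow_apply]
    rw [← h2]
    by_cases hy : y ∈ B
    · simp only [Set.indicator_of_mem hy, Pi.one_apply] at h1 ⊢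
      exact pow_le_one₀ (abs_nonneg _) h1
    · simp only [Set.indicator_of_notMem hy] at h1 ⊢
      rw [le_antisymm h1 (abs_nonneg _)]
      norm_num
  have hint : ∫ x : Fin n → X, (∑ i, fun x : Fin n → X => f (x i)) x ∂(Measure.pi fun _ => P) =
      n * ∫ y, f y ∂P := by
    simp only [Finset.sum_apply]
    rw [integral_finsetSum _ fun i _ => (hfi i).integrable (by norm_num)]
    have : ∀ i : Fin n, ∫ x : Fin n → X, f (x i) ∂(Measure.pi fun _ => P) = ∫ y, f y ∂P := by
      intro i
      have hi := measurePreserving_eval (fun _ : Fin n => P) i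
      have h := integral_map (f := f) (μ := Measure.pi fun _ : Fin n => P) hi.measurable.aemeasurable
        hf.aestronglyMeasurable
      rw [hi.map_eq] at h
      exact h.symm
    simp [this]
  have hc : 0 < 2 * √(n * P.real B + 1) := by positivity
  have hc2 : (2 * √(n * P.real B + 1)) ^ 2 = 4 * (n * P.real B + 1) := by
    rw [mul_pow, Real.sq_sqrt (by positivity)]; norm_num
  have h := meas_ge_le_variance_div_sq (memLp_finsetSum' Finset.univ fun i _ => hfi i) hc
  rw [hint, variance_sum_pi (fun _ => hfL), hc2] at h
  refine (measure_mono fun x hx => ?_).trans (h.trans ?_)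
  · simp only [Set.mem_ofPred_eq, Finset.sum_apply] at hx ⊢
    rw [← hc2] at hx
    exact abs_le_of_sq_le_sq' (by simpa using hx) (abs_nonneg _) |>.2
  · rw [show (1 / 4 : ENNReal) = ENNReal.ofReal (1 / 4) by
      rw [ENNReal.ofReal_div_of_pos (by norm_num)]; simp]
    refine ENNReal.ofReal_le_ofReal ?_
    rw [div_le_div_iff₀ (by positivity) (by norm_num)]
    simp only [Finset.sum_const, Finset.card_univ, Fintype.card_fin, nsmul_eq_mul]
    nlinarith [mul_le_mul_of_nonneg_left hvar (Nat.cast_nonneg (α := ℝ) n)]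

/-- The first symmetrization step: a set of samples that are completed to an element of `G` by a
ghost sample with probability at least `1 / 2`. -/
theorem pi_le_two_mul_of_half_le_section {X : Type*} [MeasurableSpace X] {P : Measure X}
    [IsProbabilityMeasure P] {n : ℕ} {S : Set (Fin n → X)} {G : Set (Fin n ⊕ Fin n → X)}
    (h : ∀ x ∈ S, 1 / 2 ≤ (Measure.pi fun _ => P) {y : Fin n → X | Sum.elim x y ∈ G}) :
    (Measure.pi fun _ => P) S ≤ 2 * (Measure.pi fun _ => P) G := by
  -- A measurable hull has the same measure and lets Fubini and Markov apply without measurability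
  -- of `S` or `G`.
  set G' := toMeasurable (Measure.pi fun _ : Fin n ⊕ Fin n => P) G
  have hG' : MeasurableSet G' := measurableSet_toMeasurable _ _
  have he := measurePreserving_sumPiEquivProdPi_symm fun _ : Fin n ⊕ Fin n => P
  set e := (MeasurableEquiv.sumPiEquivProdPi fun _ : Fin n ⊕ Fin n => X).symm
  have hm : MeasurableSet (e ⁻¹' G') := e.measurable hG'
  have hsub : S ⊆ {x | 1 / 2 ≤ (Measure.pi fun _ : Fin n => P) (Prod.mk x ⁻¹' (e ⁻¹' G'))} := by
    intro x hx
    refine (h x hx).trans (measure_mono fun y hy => ?_)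
    exact subset_toMeasurable _ _ hy
  have hmarkov := mul_meas_ge_le_lintegral (μ := Measure.pi fun _ : Fin n => P)
    (measurable_measure_prodMk_left (ν := Measure.pi fun _ : Fin n => P) hm) (1 / 2)
  rw [← Measure.prod_apply hm, he.measure_preimage hG'.nullMeasurableSet,
    measure_toMeasurable] at hmarkov
  refine (measure_mono hsub).trans ?_
  rw [one_div] at hmarkov ⊢
  have h2 := mul_le_mul_right hmarkov 2
  rwa [← mul_assoc, ENNReal.mul_inv_cancel (by simp) (by simp), one_mul] at h2

/-- Here `a`, `b` count `A ∩ B` and `B` in the sample, `a'`, `b'` in the ghost sample, and `q = n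
P(B)`. The proof splits `a - p b = (a' - p b') + (a - a') - p (b - b')`. Without disagreement the
squares are below `36b`, `12kb` and `12kb`, so the left side squared is at most `180kb`, against
`1000kb`. -/
theorem halves_disagree_of_deviation {a b a' b' p q k : ℝ} (hk : 1 ≤ k) (hp0 : 0 ≤ p) (hp1 : p ≤ 1)
    (hq : 0 ≤ q) (ha : 0 ≤ a) (hab : a ≤ b) (hb : 0 < b) (hb' : 0 ≤ b')
    (hdev : √(1000 * k / b) < |p - a / b|) (h1 : (b' - q) ^ 2 < 4 * (q + 1))
    (h2 : (a' - p * b') ^ 2 < 4 * (q + 1)) :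
    4 * k * (b + b') < (a - a') ^ 2 ∨ 4 * k * (b + b') < (b - b') ^ 2 := by
  by_contra! hcon
  obtain ⟨hA, hB⟩ := hcon
  have hab0 : 0 ≤ a / b := by positivity
  have hab1 : a / b ≤ 1 := (div_le_one hb).2 hab
  have hdev2 : 1000 * k / b < (p - a / b) ^ 2 := by
    have := pow_lt_pow_left₀ hdev (Real.sqrt_nonneg _) two_ne_zero
    rwa [Real.sq_sqrt (by positivity), sq_abs] at this
  -- Both conditional frequencies lie in `[0, 1]`, so a violation forces `b` to be large.
  have hbk : 1000 * k < b := by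
    have : 1000 * k / b < 1 := hdev2.trans_le (by nlinarith)
    exact (div_lt_one hb).1 this
  have hdev3 : 1000 * k * b < (a - p * b) ^ 2 := by
    have h := mul_lt_mul_of_pos_right hdev2 (by positivity : 0 < b ^ 2)
    have e1 : 1000 * k / b * b ^ 2 = 1000 * k * b := by field_simp
    have e2 : (p - a / b) ^ 2 * b ^ 2 = (a - p * b) ^ 2 := by field_simp; ring
    rwa [e1, e2] at h
  have hb2 : b' ≤ 2 * b := by
    by_contra! hlt
    nlinarith
  have hq9 : q + 1 ≤ 9 * b := by
    by_contra! hlt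
    have h3 : (q + 1) / 2 ≤ q - b' := by linarith
    nlinarith
  have hpB : (p * (b - b')) ^ 2 ≤ (b - b') ^ 2 := by
    rw [mul_pow]
    exact mul_le_of_le_one_left (sq_nonneg _) (pow_le_one₀ hp0 hp1)
  have hsq : (a - p * b) ^ 2 ≤
      3 * ((a' - p * b') ^ 2 + (a - a') ^ 2 + (p * (b - b')) ^ 2) := by
    nlinarith [sq_nonneg ((a' - p * b') - (a - a')), sq_nonneg ((a' - p * b') + p * (b - b')),
      sq_nonneg ((a - a') + p * (b - b'))]
  have hkb : k * b' ≤ k * (2 * b) := mul_le_mul_of_nonneg_left hb2 (by linarith)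
  nlinarith

theorem half_le_measure_section_disagreementSet {X : Type*} [MeasurableSpace X] {P : Measure X}
    [IsProbabilityMeasure P] {𝒜 ℬ : Set (Set X)} {A B : Set X} (hA𝒜 : A ∈ 𝒜) (hBℬ : B ∈ ℬ)
    (hA : MeasurableSet A) (hB : MeasurableSet B) {n : ℕ} {x : Fin n → X} {k : ℝ} (hk : 1 ≤ k)
    (hpos : 0 < sampleCount x B)
    (hdev : √(1000 * k / sampleCount x B) < |(cond P B).real A - empiricalCond x A B|) :
    1 / 2 ≤ (Measure.pi fun _ => P)
      {y : Fin n → X | Sum.elim x y ∈ disagreementSet 𝒜 ℬ k} := by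
  set p := (cond P B).real A with hp
  have hp0 : 0 ≤ p := measureReal_nonneg
  have hp1 : p ≤ 1 := by
    by_cases hPB : P B = 0
    · rw [hp, cond_eq_zero_of_meas_eq_zero hPB]; simp
    · have := cond_isProbabilityMeasure hPB
      exact measureReal_le_one
  have hpB : P.real (A ∩ B) = p * P.real B := by
    rw [hp, measureReal_def (cond P B), cond_apply hB, ENNReal.toReal_mul, ENNReal.toReal_inv,
      Set.inter_comm, ← measureReal_def, ← measureReal_def]
    by_cases hPB : P.real B = 0
    · rw [hPB, mul_zero]
      exact measureReal_mono_null Set.inter_subset_left hPB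
    · field_simp
  have hind : ∀ {C : Set X}, MeasurableSet C → Measurable (C.indicator (1 : X → ℝ)) :=
    fun hC => measurable_one.indicator hC
  have hintb : ∀ {C : Set X}, MeasurableSet C → Integrable (C.indicator (1 : X → ℝ)) P :=
    fun hC => (integrable_const 1).indicator hC
  have hAB := hA.inter hB
  have h1 := pi_sum_deviation_le (P := P) n (hind hB) hB fun y => by
    rw [abs_of_nonneg (Set.indicator_nonneg (by simp) y)]
  -- With `p = P(A | B)` this function has mean zero, including when `P B = 0`.
  have h2 := pi_sum_deviation_le (P := P) n
    (f := fun y => (A ∩ B).indicator 1 y - p * B.indicator 1 y)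
    ((hind hAB).sub ((hind hB).const_mul p)) hB fun y => by
      by_cases hyB : y ∈ B
      · by_cases hyA : y ∈ A
        · simp only [Set.indicator_of_mem hyB, Set.indicator_of_mem (Set.mem_inter hyA hyB),
            Pi.one_apply, abs_le]
          constructor <;> linarith
        · simp only [Set.indicator_of_mem hyB, Pi.one_apply, abs_le,
            Set.indicator_of_notMem fun h : y ∈ A ∩ B => hyA h.1]
          constructor <;> linarith
      · simp [hyB]
  rw [integral_indicator_one hB] at h1
  rw [integral_sub (hintb hAB) ((hintb hB).const_mul p), integral_const_mul,
    integral_indicator_one hAB, integral_indicator_one hB, hpB, sub_self, mul_zero] at h2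
  set q := n * P.real B with hq
  set U₁ := {y : Fin n → X | 4 * (q + 1) ≤ (∑ i, B.indicator 1 (y i) - q) ^ 2}
  set U₂ := {y : Fin n → X | 4 * (q + 1) ≤
    (∑ i, ((A ∩ B).indicator 1 (y i) - p * B.indicator 1 (y i)) - 0) ^ 2}
  set V := {y : Fin n → X | Sum.elim x y ∈ disagreementSet 𝒜 ℬ k}
  have hcover : Set.univ ⊆ V ∪ (U₁ ∪ U₂) := by
    intro y _
    by_contra hy
    simp only [Set.mem_union, not_or] at hy
    obtain ⟨hV, hU₁, hU₂⟩ := hy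
    simp only [U₁, U₂, Set.mem_ofPred_eq, not_le, sub_zero, Finset.sum_sub_distrib,
      ← Finset.mul_sum, ← sampleCount_eq_sum] at hU₁ hU₂
    refine hV ⟨A, hA𝒜, B, hBℬ, ?_⟩
    rw [HalvesDisagree, ← Set.preimage_inter, halfSum_sumElim, halfDiff_sumElim, halfDiff_sumElim]
    refine halves_disagree_of_deviation hk hp0 hp1 (by positivity) (by positivity) ?_
      (by exact_mod_cast hpos) (by positivity) hdev hU₁ hU₂
    exact_mod_cast Set.ncard_le_ncard (fun i (hi : x i ∈ A ∩ B) => hi.2) (Set.toFinite _)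
  have hle : 1 ≤ (Measure.pi fun _ => P) V + 1 / 2 := by
    calc 1 = (Measure.pi fun _ : Fin n => P) Set.univ := by simp
      _ ≤ _ := measure_mono hcover
      _ ≤ _ := measure_union_le _ _
      _ ≤ _ + (1 / 4 + 1 / 4) := by
          gcongr
          exact (measure_union_le _ _).trans (add_le_add h1 h2)
      _ = _ := by
          congr 1
          rw [ENNReal.div_add_div_same, one_add_one_eq_two]
          refine (ENNReal.div_eq_div_iff ?_ ?_ ?_ ?_).2 ?_ <;> norm_num
  have h12 : (1 : ENNReal) / 2 = 1 - 1 / 2 := by simp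
  rw [h12]
  exact tsub_le_iff_right.2 hle

/-! ### Constants and conclusion -/

theorem two_mul_growth_bound_le {n d : ℕ} (hn : 0 < n) {δ : ℝ} (hδ : 0 < δ) (hδ1 : δ ≤ 1) :
    2 * (((2 * n + 1) ^ d) ^ 2 *
      (4 * Real.exp (-(2 * (d * Real.log (8 * n) + Real.log (4 / δ)))))) ≤ δ := by
  have hn1 : (1 : ℝ) ≤ n := by exact_mod_cast hn
  have hexp : Real.exp (d * Real.log (8 * n) + Real.log (4 / δ)) = (8 * n) ^ d * (4 / δ) := by
    rw [Real.exp_add, Real.exp_log (by positivity), Real.exp_nat_mul, Real.exp_log (by positivity)]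
  have hN : ((2 * n + 1) ^ d : ℝ) ≤ (8 * n) ^ d :=
    pow_le_pow_left₀ (by positivity) (by linarith) d
  have hM : (0 : ℝ) < (8 * n) ^ d := by positivity
  rw [Real.exp_neg, two_mul (_ + _), Real.exp_add, hexp]
  set M : ℝ := (8 * n) ^ d
  calc _ ≤ 2 * (M ^ 2 * (4 * (M * (4 / δ) * (M * (4 / δ)))⁻¹)) := by gcongr
    -- The factor 2 in the exponent cancels the squared growth function and leaves `δ²`.
    _ = δ * δ / 2 := by field_simp; norm_num
    _ ≤ δ := by nlinarith

theorem mainTheorem3 {X : Type*} [MeasurableSpace X] (P : Measure X) [IsProbabilityMeasure P]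
    (𝒜 ℬ : Set (Set X))
    (h𝒜 : ∀ A ∈ 𝒜, MeasurableSet A) (hℬ : ∀ B ∈ ℬ, MeasurableSet B)
    (hmeas : SampleMeasurable P 𝒜 ℬ)
    (d₀ : ℕ) (hVC𝒜 : familyVCDim 𝒜 ≤ (d₀ : ℕ∞)) (hVCℬ : familyVCDim ℬ ≤ (d₀ : ℕ∞))
    {Ω : Type*} [MeasurableSpace Ω] (μ : Measure Ω) [IsProbabilityMeasure μ]
    (n : ℕ) (x : Fin n → Ω → X) (hlaw : ∀ i, HasLaw (x i) P μ) (hindep : iIndepFun x μ)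
    (δ : ℝ) (hδ : 0 < δ) :
    ∃ E : Set Ω, MeasurableSet E ∧ 1 - δ ≤ μ.real E ∧
      ∀ ω ∈ E, ∀ A ∈ 𝒜, ∀ B ∈ ℬ, 0 < sampleCount (fun i => x i ω) B →
        |(ProbabilityTheory.cond P B).real A - empiricalCond (fun i => x i ω) A B| ≤
          Real.sqrt (1000 * ((d₀ : ℝ) * Real.log (8 * (n : ℝ)) + Real.log (4 / δ)) /
            (sampleCount (fun i => x i ω) B : ℝ)) := by
  rcases lt_or_ge 1 δ with hδ1 | hδ1
  · exact ⟨∅, MeasurableSet.empty, by simpa using hδ1.le, by simp⟩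
  rcases n.eq_zero_or_pos with rfl | hn
  · refine ⟨Set.univ, MeasurableSet.univ, by simpa using hδ.le, fun ω _ A _ B _ h => ?_⟩
    simp [sampleCount, Set.eq_empty_of_isEmpty] at h
  set k : ℝ := d₀ * Real.log (8 * n) + Real.log (4 / δ) with hkdef
  have hn1 : (1 : ℝ) ≤ n := by exact_mod_cast hn
  have hk : 1 ≤ k := by
    have h1 : 0 ≤ Real.log (8 * n) := Real.log_nonneg (by linarith)
    have h2 : 1 ≤ Real.log (4 / δ) := by
      rw [Real.le_log_iff_exp_le (by positivity), le_div_iff₀ hδ]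
      nlinarith [Real.exp_one_lt_three, Real.exp_pos 1]
    have h3 : 0 ≤ d₀ * Real.log (8 * n) := by positivity
    linarith
  set bad : Set (Fin n → X) := {y | ∃ A ∈ 𝒜, ∃ B ∈ ℬ, 0 < sampleCount y B ∧
    √(1000 * k / sampleCount y B) < |(cond P B).real A - empiricalCond y A B|}
  have hbad_le : (Measure.pi fun _ => P) bad ≤ ENNReal.ofReal δ := by
    have h1 : (Measure.pi fun _ => P) bad ≤
        2 * (Measure.pi fun _ => P) (disagreementSet (ι := Fin n) 𝒜 ℬ k) := by
      refine pi_le_two_mul_of_half_le_section ?_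
      rintro y ⟨A, hA, B, hB, hpos, hdev⟩
      exact half_le_measure_section_disagreementSet hA hB (h𝒜 A hA) (hℬ B hB) hk hpos hdev
    refine h1.trans ((mul_le_mul_right (measure_disagreementSet_le hmeas hVC𝒜 hVCℬ n
      (zero_le_one.trans hk)) 2).trans ?_)
    rw [← ENNReal.ofReal_ofNat 2, ← ENNReal.ofReal_mul (by norm_num)]
    exact ENNReal.ofReal_le_ofReal (two_mul_growth_bound_le hn hδ hδ1)
  have hx : ∀ i, AEMeasurable (x i) μ := fun i => (hlaw i).aemeasurable
  have hmap : μ.map (fun ω i => x i ω) = Measure.pi fun _ => P := by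
    rw [hindep.map_fun_eq_pi_map hx]
    simp_rw [(hlaw _).map_eq]
  set T := toMeasurable (Measure.pi fun _ => P) bad
  set S := (fun ω i => x i ω) ⁻¹' T with hS
  have hμS : μ S ≤ ENNReal.ofReal δ := by
    rw [hS, ← Measure.map_apply_of_aemeasurable (aemeasurable_pi_lambda _ hx)
      (measurableSet_toMeasurable _ _), hmap, measure_toMeasurable]
    exact hbad_le
  -- A second hull is needed because the `x i` are only almost everywhere measurable, so `S` need
  -- not be measurable.
  refine ⟨(toMeasurable μ S)ᶜ, (measurableSet_toMeasurable _ _).compl, ?_, ?_⟩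
  · rw [probReal_compl_eq_one_sub (measurableSet_toMeasurable _ _), measureReal_def,
      measure_toMeasurable]
    linarith [ENNReal.toReal_le_of_le_ofReal hδ.le hμS]
  · intro ω hω A hA B hB hpos
    by_contra! hdev
    exact hω (subset_toMeasurable _ _ (subset_toMeasurable _ _ ⟨A, hA, B, hB, hpos, hdev⟩))
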